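/- Let $(\mathcal X,d)$ be a complete separable metric space, $K\ge 2$, $[K]=\{1,\dots,K\}$, and let $c:\mathcal X\times\mathcal X\to[0,\infty]$ be lower semicontinuous with $c(x,x)=0$ for all $x$, and such that whenever $(x_n)$ is a bounded sequence and $\sup_n c(x_n',x_n)<\infty$, the set $\{(x_n',x_n)\}_n$ is precompact in $\mathcal X\times\mathcal X$. (Here $c(x',x)$ is the cost of moving the data point $x$ to $x'$; $c$ need not be symmetric.) For finite positive Borel measures $\nu,\rho$ on $\mathcal X$ let $C(\nu,\rho)=\inf_\pi\int c(x',x)\,d\pi(x',x)\in[0,\infty]$, the infimum being over all positive measures $\pi$ on $\mathcal X\times\mathcal X$ with first marginal $\nu$ and second marginal $\rho$ ($C=\infty$ if there are none). For a finite positive Borel measure $\mu$ on $\mathcal X\times[K]$ put $\mu_i(E)=\mu(E\times\{i\})$ and define the generalized barycenter value $$B^*_\mu=\inf\Big\{\lambda(\mathcal X)+\sum_{i\in[K]}C(\widetilde\mu_i,\mu_i)\;:\;\lambda,\widetilde\mu_1,\dots,\widetilde\mu_K\text{ finite positive Borel measures on }\mathcal X,\ \widetilde\mu_i\le\lambda\text{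 for all }i\in[K]\Big\}.$$ Let $S_K$ be the set of nonempty subsets of $[K]$. For $A\in S_K$ let $c_A(x_1,\dots,x_K)=\inf_{x'\in\mathcal X}\sum_{i\in A}c(x',x_i)\in[0,\infty]$, and for $x_i\in\mathcal X$, $r_i\in[0,1]$ let $$\widetilde c\big((x_1,r_1),\dots,(x_K,r_K)\big)=\inf\Big\{\sum_{A\in S_K}m_A\big(c_A(x_1,\dots,x_K)+1\big)\;:\;m:S_K\to[0,\infty),\ \sum_{A\in S_K,\,A\ni i}m_A=r_i\text{ for all }i\in[K]\Big\},$$ with the convention $0\cdot\infty=0$. Then for all $x_1,\dots,x_K\in\mathcal X$ and $r_1,\dots,r_K\in[0,1]$, $$\widetilde c\big((x_1,r_1),\dots,(x_K,r_K)\big)=B^*_{\widehat\mu},\qquad \widehat\mu=\sum_{i\in[K]}r_i\,\delta_{(x_i,i)}.$$ -/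

import Mathlib

open MeasureTheory
open scoped ENNReal NNReal

namespace AdvMOT

/-- Standing assumptions on a transport cost `c : X × X → [0, ∞]`, where `c x' x` is the cost of
moving the data point `x` to the point `x'`: lower semicontinuity, `c x x = 0`, and coercivity:
if `x n` is bounded and `c (x' n) (x n)` is uniformly bounded by a finite number, then the set of
pairs `(x' n, x n)` is precompact. -/
structure AdmissibleCost {X : Type*} [MetricSpace X] (c : X → X → ℝ≥0∞) : Prop where
  lowerSemicontinuous : LowerSemicontinuous (fun p : X × X => c p.1 p.2)
  self_eq_zero : ∀ x, c x x = 0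
  precompact : ∀ x x' : ℕ → X, Bornology.IsBounded (Set.range x) →
    (⨆ n, c (x' n) (x n)) < ∞ →
    IsCompact (closure (Set.range fun n => (x' n, x n)))

/-- `Γ(ν, μ)`: positive measures on `X × X` with first marginal `ν` and second marginal `μ`. -/
def couplings {X : Type*} [MeasurableSpace X] (ν μ : Measure X) : Set (Measure (X × X)) :=
  {π | π.map Prod.fst = ν ∧ π.map Prod.snd = μ}

/-- Optimal transport cost `C(ν, μ) = inf_{π ∈ Γ(ν, μ)} ∫ c(x', x) dπ(x', x)`, which is `∞` if there
is no coupling. -/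
noncomputable def transportCost {X : Type*} [MeasurableSpace X] (c : X → X → ℝ≥0∞)
    (ν μ : Measure X) : ℝ≥0∞ :=
  ⨅ π ∈ couplings ν μ, ∫⁻ p, c p.1 p.2 ∂π

/-- The measure `μ_i(E) = μ(E × {i})` of points with label `i`. -/
noncomputable def labelPart {X : Type*} [MeasurableSpace X] {K : ℕ}
    (μ : Measure (X × Fin K)) (i : Fin K) : Measure X :=
  (μ.restrict (Prod.snd ⁻¹' {i})).map Prod.fst

/-- The generalized barycenter value `B*_μ`: the infimum of `λ(X) + ∑ i, C(μ̃_i, μ_i)` over finite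
positive Borel measures `λ, μ̃_1, …, μ̃_K` on `X` with `μ̃_i ≤ λ` for all `i`. -/
noncomputable def barycenterValue {X : Type*} [MeasurableSpace X] {K : ℕ} (c : X → X → ℝ≥0∞)
    (μ : Measure (X × Fin K)) : ℝ≥0∞ :=
  sInf {v | ∃ (lam : Measure X) (mt : Fin K → Measure X),
    IsFiniteMeasure lam ∧ (∀ i, IsFiniteMeasure (mt i)) ∧ (∀ i, mt i ≤ lam) ∧
    v = lam Set.univ + ∑ i, transportCost c (mt i) (labelPart μ i)}

/-- `c_A(x_1, …, x_K) = inf_{x'} ∑_{i ∈ A} c(x', x_i)`. -/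
noncomputable def groupCost {X : Type*} {K : ℕ} (c : X → X → ℝ≥0∞) (A : Finset (Fin K))
    (x : Fin K → X) : ℝ≥0∞ :=
  ⨅ x' : X, ∑ i ∈ A, c x' (x i)

/-- `S_K`: the nonempty subsets of the label set. -/
abbrev LabelGroup (K : ℕ) : Type := {A : Finset (Fin K) // A.Nonempty}

/-- The cost `c̃` on `(X × [0,1])^K`: the infimum of `∑_{A ∈ S_K} m_A (c_A(x) + 1)` over
non-negative weights `m` on `S_K` with `∑_{A ∋ i} m_A = r_i` for every label `i`. -/
noncomputable def motCost {X : Type*} {K : ℕ} (c : X → X → ℝ≥0∞)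
    (p : Fin K → X × Set.Icc (0 : ℝ) 1) : ℝ≥0∞ :=
  ⨅ (m : LabelGroup K → ℝ≥0)
    (_ : ∀ i, ∑ A : LabelGroup K with i ∈ A.1, (m A : ℝ) = ((p i).2 : ℝ)),
    ∑ A : LabelGroup K, (m A : ℝ≥0∞) * (groupCost c A.1 (fun i => (p i).1) + 1)

/-- `μ̂ = ∑ i, r_i δ_{(x_i, i)}`. -/
noncomputable def localMeasure {X : Type*} [MeasurableSpace X] {K : ℕ} (x : Fin K → X)
    (r : Fin K → Set.Icc (0 : ℝ) 1) : Measure (X × Fin K) :=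
  ∑ i, ENNReal.ofReal (r i : ℝ) • Measure.dirac (x i, i)

end AdvMOT

/-! Weights on label groups and dominated families of measures encode each other. Given weights `m`,
put mass `m A` at a near-minimiser of `groupCost c A x`; the total is `lam`, and the groups
containing `i` make up `mt i`. This bounds the barycenter value by `motCost` up to `ε`
(`barycenterValue_le_of_weights`). Conversely, if `mt i ≤ lam`, each `mt i` has a density at most 1,
so it is the projection of a set `S i` under `lam` times Lebesgue measure on (0,1)
(`exists_common_lift`). The points lying in exactly the `S i` with `i ∈ A` form an atom, whose mass
is taken as the weight of `A`. On that atom the moving cost is pointwise at least `groupCost c A x`.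
Transport onto a multiple of a Dirac mass is forced, so integrating gives `motCost_le_of_dominated`.
-/

namespace AdvMOT

/-! ### Dominated measures as projections of sets -/

section Disintegration

variable {X : Type*} [MeasurableSpace X]

/-- Restricting `lam ⊗ Leb(0,1)` to the subgraph of a density `f ≤ 1` and projecting on the first
coordinate yields the measure with density `f`. -/
lemma setLIntegral_subgraph (lam : Measure X) [IsFiniteMeasure lam] {f : X → ℝ≥0∞}
    (hf : Measurable f) (hf1 : ∀ᵐ y ∂lam, f y ≤ 1) {g : X → ℝ≥0∞} (hg : Measurable g) :
    ∫⁻ p in {p : X × ℝ | ENNReal.ofReal p.2 < f p.1}, g p.1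
        ∂(lam.prod (volume.restrict (Set.Ioo (0 : ℝ) 1))) =
      ∫⁻ y, g y ∂(lam.withDensity f) := by
  have hS : MeasurableSet {p : X × ℝ | ENNReal.ofReal p.2 < f p.1} :=
    measurableSet_lt (by fun_prop) (by fun_prop)
  rw [← lintegral_indicator hS, lintegral_prod _ (by measurability),
    lintegral_withDensity_eq_lintegral_mul _ hf hg]
  refine lintegral_congr_ae ?_
  filter_upwards [hf1] with y hy
  have hfin : f y ≠ ∞ := ne_top_of_le_ne_top ENNReal.one_ne_top hy
  have hy' : (f y).toReal ≤ 1 := ENNReal.toReal_le_of_le_ofReal zero_le_one (by simpa using hy)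
  have hSy : MeasurableSet {t : ℝ | ENNReal.ofReal t < f y} :=
    measurableSet_lt (by fun_prop) measurable_const
  have hind : (fun t : ℝ => ({p : X × ℝ | ENNReal.ofReal p.2 < f p.1}.indicator
      (fun p => g p.1) (y, t))) = {t : ℝ | ENNReal.ofReal t < f y}.indicator (fun _ => g y) := by
    ext t
    simp [Set.indicator]
  -- The slice over `y` is an interval of length `f y`; `f y ≤ 1` ensures that nothing is cut off at
  -- 1.
  have hset : {t : ℝ | ENNReal.ofReal t < f y} ∩ Set.Ioo 0 1 = Set.Ioo 0 (f y).toReal := by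
    ext t
    simp only [Set.mem_inter_iff, Set.mem_ofPred_eq, Set.mem_Ioo]
    constructor
    · rintro ⟨h, h0, -⟩
      exact ⟨h0, (ENNReal.ofReal_lt_iff_lt_toReal h0.le hfin).1 h⟩
    · rintro ⟨h0, h⟩
      exact ⟨(ENNReal.ofReal_lt_iff_lt_toReal h0.le hfin).2 h, h0, h.trans_le hy'⟩
  rw [hind, lintegral_indicator hSy, lintegral_const, Measure.restrict_apply_univ,
    Measure.restrict_apply hSy, hset, Real.volume_Ioo, sub_zero, ENNReal.ofReal_toReal hfin,
    Pi.mul_apply, mul_comm]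

/-- Measures dominated by `lam` are the projections of restrictions of a single finite measure,
of the same total mass as `lam`, to measurable sets. -/
lemma exists_common_lift {ι : Type*} [Finite ι] (lam : Measure X) [IsFiniteMeasure lam]
    (mt : ι → Measure X) (hle : ∀ i, mt i ≤ lam) :
    ∃ (ρ : Measure (X × ℝ)) (S : ι → Set (X × ℝ)), ρ Set.univ = lam Set.univ ∧
      (∀ i, MeasurableSet (S i)) ∧ ∀ i (g : X → ℝ≥0∞), Measurable g →
        ∫⁻ p in S i, g p.1 ∂ρ = ∫⁻ y, g y ∂(mt i) := by
  have hfin : ∀ i, IsFiniteMeasure (mt i) := fun i => isFiniteMeasure_of_le lam (hle i)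
  refine ⟨lam.prod (volume.restrict (Set.Ioo (0 : ℝ) 1)),
    fun i => {p | ENNReal.ofReal p.2 < (mt i).rnDeriv lam p.1}, ?_, fun i => ?_,
    fun i g hg => ?_⟩
  · rw [← Set.univ_prod_univ, Measure.prod_prod]
    simp
  · exact measurableSet_lt (by fun_prop)
      ((Measure.measurable_rnDeriv _ _).comp measurable_fst)
  · rw [setLIntegral_subgraph lam (Measure.measurable_rnDeriv _ _)
      (Measure.rnDeriv_le_one_of_le (hle i)) hg,
      Measure.withDensity_rnDeriv_eq _ _ (Measure.absolutelyContinuous_of_le (hle i))]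

end Disintegration

/-! ### Group costs and transport onto Dirac masses -/

variable {X : Type*} {K : ℕ}

lemma groupCost_le (c : X → X → ℝ≥0∞) (A : Finset (Fin K)) (x : Fin K → X) (y : X) :
    groupCost c A x ≤ ∑ i ∈ A, c y (x i) :=
  iInf_le _ y

lemma exists_sum_le_groupCost_add [Nonempty X] (c : X → X → ℝ≥0∞) (A : Finset (Fin K))
    (x : Fin K → X) {ε : ℝ≥0∞} (hε : ε ≠ 0) :
    ∃ y, ∑ i ∈ A, c y (x i) ≤ groupCost c A x + ε := by
  by_cases h : groupCost c A x = ∞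
  · exact ⟨Classical.arbitrary X, by simp [h]⟩
  · obtain ⟨y, hy⟩ := iInf_lt_iff.1 (ENNReal.lt_add_right h hε)
    exact ⟨y, hy.le⟩

variable [MeasurableSpace X]

lemma labelPart_localMeasure (x : Fin K → X) (r : Fin K → Set.Icc (0 : ℝ) 1) (i : Fin K) :
    labelPart (localMeasure x r) i = ENNReal.ofReal (r i : ℝ) • Measure.dirac (x i) := by
  ext s hs
  have hi : MeasurableSet (Prod.snd ⁻¹' {i} : Set (X × Fin K)) :=
    measurable_snd (measurableSet_singleton i)
  rw [labelPart, Measure.map_apply measurable_fst hs,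
    Measure.restrict_apply (measurable_fst hs), localMeasure, Measure.finsetSum_apply]
  rw [Finset.sum_eq_single i]
  · rw [Measure.smul_apply, Measure.smul_apply,
      Measure.dirac_apply' _ ((measurable_fst hs).inter hi), Measure.dirac_apply' _ hs]
    have hmem : (x i, i) ∈ Prod.fst ⁻¹' s ∩ Prod.snd ⁻¹' {i} ↔ x i ∈ s := by simp
    by_cases h : x i ∈ s
    · rw [Set.indicator_of_mem (hmem.2 h), Set.indicator_of_mem h]; rfl
    · rw [Set.indicator_of_notMem (mt hmem.1 h), Set.indicator_of_notMem h]
  · intro j _ hj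
    rw [Measure.smul_apply, Measure.dirac_apply' _ ((measurable_fst hs).inter hi)]
    simp [hj]
  · simp

/-- The only transport plans onto a multiple of a Dirac mass send everything to its atom. -/
lemma le_transportCost_smul_dirac [MeasurableSingletonClass X] {c : X → X → ℝ≥0∞} {a : ℝ≥0∞}
    {y : X} (hc : Measurable fun z => c z y) (ν : Measure X) :
    ∫⁻ z, c z y ∂ν ≤ transportCost c ν (a • Measure.dirac y) := by
  refine le_iInf₂ fun π hπ => ?_
  obtain ⟨h1, h2⟩ := hπ
  rw [← h1, lintegral_map hc measurable_fst]
  refine (lintegral_congr_ae ?_).le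
  have h : ∀ᵐ z ∂(π.map Prod.snd), z = y := by
    rw [h2]
    exact Measure.ae_smul_measure (by simp [ae_dirac_eq]) a
  filter_upwards [ae_of_ae_map measurable_snd.aemeasurable h] with p hp
  rw [hp]

lemma measure_univ_eq_of_coupling {ν μ : Measure X} {π : Measure (X × X)}
    (hπ : π ∈ couplings ν μ) : ν Set.univ = μ Set.univ := by
  rw [← hπ.1, ← hπ.2, Measure.map_apply measurable_fst .univ,
    Measure.map_apply measurable_snd .univ, Set.preimage_univ, Set.preimage_univ]

lemma measure_univ_eq_of_transportCost_ne_top {c : X → X → ℝ≥0∞} {ν μ : Measure X}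
    (h : transportCost c ν μ ≠ ∞) : ν Set.univ = μ Set.univ := by
  by_contra hne
  refine h (iInf₂_eq_top.2 fun π hπ => ?_)
  exact absurd (measure_univ_eq_of_coupling hπ) hne

/-! ### From dominated measures to weights -/

/-- Every competitor in the barycenter problem yields weights on label groups of no larger cost. -/
lemma motCost_le_of_dominated {c : X → X → ℝ≥0∞} {x : Fin K → X} {r : Fin K → Set.Icc (0 : ℝ) 1}
    (hc : ∀ i, Measurable fun z => c z (x i)) (lam : Measure X) [IsFiniteMeasure lam]
    (mt : Fin K → Measure X) (hle : ∀ i, mt i ≤ lam)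
    (hmass : ∀ i, mt i Set.univ = ENNReal.ofReal (r i : ℝ)) :
    motCost c (fun i => (x i, r i)) ≤
      lam Set.univ + ∑ i, ∫⁻ z, c z (x i) ∂(mt i) := by
  classical
  obtain ⟨ρ, S, hρ, hS, hint⟩ := exists_common_lift lam mt hle
  have : IsFiniteMeasure ρ := ⟨hρ ▸ measure_lt_top lam _⟩
  -- Atoms of the algebra generated by the `S i`, leaving out the points that lie in no `S i`.
  let B : LabelGroup K → Set (X × ℝ) := fun A => {p | ∀ i, p ∈ S i ↔ i ∈ A.1}
  have hB : ∀ A, MeasurableSet (B A) := fun A => by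
    have : B A = ⋂ i, if i ∈ A.1 then S i else (S i)ᶜ := by
      ext p
      simp only [B, Set.mem_ofPred_eq, Set.mem_iInter]
      refine forall_congr' fun i => ?_
      split_ifs with h <;> simp [h]
    rw [this]
    refine MeasurableSet.iInter fun i => ?_
    split_ifs
    exacts [hS i, (hS i).compl]
  have hdisj : Pairwise (Function.onFun Disjoint B) := fun A A' hne =>
    Set.disjoint_left.2 fun p hp hp' =>
      hne (Subtype.ext (Finset.ext fun i => (hp i).symm.trans (hp' i)))
  have hmeasS : ∀ i, ρ (S i) = ENNReal.ofReal (r i : ℝ) := fun i => by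
    simpa [hmass] using hint i (fun _ => 1) measurable_const
  have hunion : ∀ i, S i = ⋃ A ∈ Finset.univ.filter (fun A : LabelGroup K => i ∈ A.1), B A := by
    intro i
    ext p
    simp only [Set.mem_iUnion, Finset.mem_filter, Finset.mem_univ, true_and, exists_prop]
    constructor
    · intro hp
      exact ⟨⟨Finset.univ.filter (fun j => p ∈ S j), ⟨i, by simpa using hp⟩⟩, by simpa using hp,
        fun j => by simp⟩
    · rintro ⟨A, hi, hp⟩
      exact (hp i).2 hi
  refine (iInf₂_le (fun A => (ρ (B A)).toNNReal) fun i => ?_).trans ?_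
  · have h : ∑ A : LabelGroup K with i ∈ A.1, ρ (B A) = ENNReal.ofReal (r i : ℝ) := by
      rw [← hmeasS i, hunion i,
        measure_biUnion_finset (fun A _ A' _ h => hdisj h) (fun A _ => hB A)]
    have h' := congrArg ENNReal.toReal h
    rwa [ENNReal.toReal_sum (fun _ _ => measure_ne_top _ _),
      ENNReal.toReal_ofReal (r i).2.1] at h'
  -- Moving cost of the labels present at `p`, plus 1 for the mass of `lam`.
  · let G : X × ℝ → ℝ≥0∞ := fun p => ∑ i, (S i).indicator (fun p => c p.1 (x i)) p + 1
    have hcm : ∀ i, Measurable fun p : X × ℝ => c p.1 (x i) :=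
      fun i => (hc i).comp measurable_fst
    calc ∑ A : LabelGroup K, ((ρ (B A)).toNNReal : ℝ≥0∞) * (groupCost c A.1 x + 1)
        ≤ ∑ A : LabelGroup K, ∫⁻ p in B A, G p ∂ρ := by
          refine Finset.sum_le_sum fun A _ => ?_
          rw [ENNReal.coe_toNNReal (measure_ne_top _ _), mul_comm, ← setLIntegral_const]
          refine setLIntegral_mono' (hB A) fun p hp => ?_
          refine add_le_add_left ((groupCost_le c A.1 x p.1).trans ?_) 1
          rw [← Finset.sum_subset (Finset.subset_univ A.1) fun i _ hi =>
            Set.indicator_of_notMem (fun h => hi ((hp i).1 h)) _]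
          refine Finset.sum_le_sum fun i hi => ?_
          rw [Set.indicator_of_mem ((hp i).2 hi)]
      _ = ∫⁻ p in ⋃ A, B A, G p ∂ρ := by
          rw [lintegral_iUnion hB hdisj, tsum_fintype]
      -- The points gained lie in no `S i`: they carry mass of `lam` that serves no label.
      _ ≤ ∫⁻ p, G p ∂ρ := setLIntegral_le_lintegral _ _
      _ = lam Set.univ + ∑ i, ∫⁻ z, c z (x i) ∂(mt i) := by
          rw [lintegral_add_right _ measurable_const,
            lintegral_finsetSum _ (fun i _ => (hcm i).indicator (hS i)), lintegral_one, hρ,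
            add_comm]
          congr 1
          refine Finset.sum_congr rfl fun i _ => ?_
          rw [lintegral_indicator (hS i), hint i _ (hc i)]

lemma motCost_le_barycenterValue [MeasurableSingletonClass X] {c : X → X → ℝ≥0∞} {x : Fin K → X}
    (hc : ∀ i, Measurable fun z => c z (x i)) (r : Fin K → Set.Icc (0 : ℝ) 1) :
    motCost c (fun i => (x i, r i)) ≤ barycenterValue c (localMeasure x r) := by
  refine le_sInf ?_
  rintro v ⟨lam, mt, hlam, -, hle, rfl⟩
  simp only [labelPart_localMeasure]
  -- Finite transport cost forces `mt i` to have mass `r i`, the constraint on the weights;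
  -- otherwise the competitor has value `∞`.
  by_cases h : ∀ i, transportCost c (mt i) (ENNReal.ofReal (r i : ℝ) • Measure.dirac (x i)) ≠ ∞
  · refine (motCost_le_of_dominated hc lam mt hle fun i => ?_).trans
      (add_le_add_right (Finset.sum_le_sum fun i _ => le_transportCost_smul_dirac (hc i) _) _)
    simpa using measure_univ_eq_of_transportCost_ne_top (h i)
  · push Not at h
    obtain ⟨i, hi⟩ := h
    rw [ENNReal.sum_eq_top.2 ⟨i, Finset.mem_univ i, hi⟩, add_top]
    exact le_top

/-! ### From weights to dominated measures -/

/-- Moving the group `A` with weight `m A` to the point `y A` is a competitor in the barycenter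
problem. -/
lemma barycenterValue_le_of_weights {c : X → X → ℝ≥0∞} {x : Fin K → X}
    {r : Fin K → Set.Icc (0 : ℝ) 1} (hc : Measurable fun p : X × X => c p.1 p.2)
    {m : LabelGroup K → ℝ≥0}
    (hm : ∀ i, ∑ A : LabelGroup K with i ∈ A.1, (m A : ℝ) = (r i : ℝ)) (y : LabelGroup K → X) :
    barycenterValue c (localMeasure x r) ≤
      ∑ A : LabelGroup K, (m A : ℝ≥0∞) * (∑ i ∈ A.1, c (y A) (x i) + 1) := by
  have hm' : ∀ i, ∑ A : LabelGroup K with i ∈ A.1, (m A : ℝ≥0∞) = ENNReal.ofReal (r i : ℝ) := by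
    intro i
    rw [← hm i, ← NNReal.coe_sum, ENNReal.ofReal_coe_nnreal, ENNReal.ofNNReal_finsetSum]
  let lam : Measure X := ∑ A : LabelGroup K, (m A : ℝ≥0∞) • Measure.dirac (y A)
  let mt : Fin K → Measure X := fun i =>
    ∑ A : LabelGroup K with i ∈ A.1, (m A : ℝ≥0∞) • Measure.dirac (y A)
  have hle : ∀ i, mt i ≤ lam := fun i => by
    refine Measure.le_iff'.2 fun s => ?_
    simp only [lam, mt, Measure.finsetSum_apply]
    exact Finset.sum_le_sum_of_subset (Finset.filter_subset _ _)
  have hlam : IsFiniteMeasure lam := ⟨by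
    simp [lam, Measure.finsetSum_apply, ENNReal.sum_lt_top]⟩
  have hval : barycenterValue c (localMeasure x r) ≤
      lam Set.univ + ∑ i, transportCost c (mt i) (labelPart (localMeasure x r) i) :=
    sInf_le ⟨lam, mt, hlam, fun i => isFiniteMeasure_of_le lam (hle i), hle, rfl⟩
  refine hval.trans ?_
  simp only [labelPart_localMeasure]
  have htr : ∀ i, transportCost c (mt i) (ENNReal.ofReal (r i : ℝ) • Measure.dirac (x i)) ≤
      ∑ A : LabelGroup K with i ∈ A.1, (m A : ℝ≥0∞) * c (y A) (x i) := by
    intro i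
    let π : Measure (X × X) :=
      ∑ A : LabelGroup K with i ∈ A.1, (m A : ℝ≥0∞) • Measure.dirac (y A, x i)
    have hπ : π ∈ couplings (mt i) (ENNReal.ofReal (r i : ℝ) • Measure.dirac (x i)) := by
      refine ⟨?_, ?_⟩
      · rw [Measure.map_finset_sum measurable_fst.aemeasurable]
        refine Finset.sum_congr rfl fun A _ => ?_
        rw [Measure.map_smul, Measure.map_dirac' measurable_fst]
      · rw [Measure.map_finset_sum measurable_snd.aemeasurable, ← hm' i, Finset.sum_smul]
        refine Finset.sum_congr rfl fun A _ => ?_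
        rw [Measure.map_smul, Measure.map_dirac' measurable_snd]
    refine (iInf₂_le π hπ).trans ?_
    rw [lintegral_finsetSum_measure]
    refine (Finset.sum_congr rfl fun A _ => ?_).le
    rw [lintegral_smul_measure, lintegral_dirac' _ hc, smul_eq_mul]
  refine (add_le_add_right (Finset.sum_le_sum fun i _ => htr i) _).trans (le_of_eq ?_)
  have hmass : lam Set.univ = ∑ A : LabelGroup K, (m A : ℝ≥0∞) := by
    simp [lam, Measure.finsetSum_apply]
  simp only [mul_add, mul_one, Finset.sum_add_distrib, Finset.mul_sum]
  rw [hmass, add_comm]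
  congr 1
  refine Finset.sum_comm' fun i A => ?_
  simp

lemma barycenterValue_le_motCost [Nonempty X] {c : X → X → ℝ≥0∞}
    (hc : Measurable fun p : X × X => c p.1 p.2) (x : Fin K → X)
    (r : Fin K → Set.Icc (0 : ℝ) 1) :
    barycenterValue c (localMeasure x r) ≤ motCost c (fun i => (x i, r i)) := by
  refine le_iInf₂ fun m hm => ?_
  let M : ℝ≥0 := ∑ A : LabelGroup K, m A
  refine ENNReal.le_of_forall_pos_le_add fun ε hε _ => ?_
  -- An error of `ε / (M + 1)` per unit of mass costs at most `ε` over the total mass `M`; the `+ 1`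
  -- covers `M = 0`.
  have hδ : ((ε / (M + 1) : ℝ≥0) : ℝ≥0∞) ≠ 0 := by
    have : 0 < ε / (M + 1) := by positivity
    exact_mod_cast this.ne'
  choose y hy using fun A : LabelGroup K => exists_sum_le_groupCost_add c A.1 x hδ
  refine (barycenterValue_le_of_weights hc hm y).trans ?_
  have hMε : ∑ A : LabelGroup K, (m A : ℝ≥0∞) * ((ε / (M + 1) : ℝ≥0) : ℝ≥0∞) ≤ ε := by
    rw [← Finset.sum_mul, ← ENNReal.ofNNReal_finsetSum, ← ENNReal.coe_mul, ENNReal.coe_le_coe,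
      mul_div_assoc', div_le_iff₀ (by positivity), mul_comm]
    exact mul_le_mul_right (le_add_of_nonneg_right zero_le_one) ε
  refine le_trans ?_ (add_le_add_right hMε _)
  rw [← Finset.sum_add_distrib]
  refine Finset.sum_le_sum fun A _ => ?_
  rw [← mul_add, add_right_comm]
  exact mul_le_mul_right (add_le_add_left (hy A) 1) _

end AdvMOT

theorem mainTheorem6 {X : Type*} [MetricSpace X] [CompleteSpace X] [TopologicalSpace.SeparableSpace X]
    [MeasurableSpace X] [BorelSpace X] (K : ℕ) (hK : 2 ≤ K)
    (c : X → X → ℝ≥0∞) (hc : AdvMOT.AdmissibleCost c)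
    (x : Fin K → X) (r : Fin K → Set.Icc (0 : ℝ) 1) :
    AdvMOT.motCost c (fun i => (x i, r i)) =
      AdvMOT.barycenterValue c (AdvMOT.localMeasure x r) := by
  have : SecondCountableTopology X := UniformSpace.secondCountable_of_separable X
  have : Nonempty X := ⟨x ⟨0, by omega⟩⟩
  have hm : Measurable fun p : X × X => c p.1 p.2 := hc.lowerSemicontinuous.measurable
  have hs (i : Fin K) : Measurable fun z => c z (x i) :=
    hm.comp (measurable_id.prodMk measurable_const)
  exact le_antisymm (AdvMOT.motCost_le_barycenterValue hs r)
    (AdvMOT.barycenterValue_le_motCost hm x r)
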